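/- Let $1<p<\infty$ and $\sigma>0$. Let $X^p(\mathbb{R}_+)$ be the space of measurable $f:\mathbb{R}_+=(0,\infty)\to\mathbb{C}$, identified when equal almost everywhere, with $\|f\|_{X^p}:=\|x^{-1/p}f(x)\|_{L^p(\mathbb{R}_+)}<\infty$, and let $\Theta=x\frac{d}{dx}$ be the infinitesimal generator of the group $U(t)f(x)=f(e^tx)$ on $X^p(\mathbb{R}_+)$, i.e. $\Theta f=\lim_{t\to0}t^{-1}(U(t)f-f)$ in the norm of $X^p(\mathbb{R}_+)$. Let $\mathbf{B}^p_\sigma(\Theta)$ be the set of all $f\in X^p(\mathbb{R}_+)$ that lie in the domain of $\Theta^k$ and satisfy $\|\Theta^kf\|_{X^p}\le\sigma^k\|f\|_{X^p}$ for every $k\in\mathbb{N}$. Put $\operatorname{sinc}(x)=\frac{\sin\pi x}{\pi x}$ for $x\ne0$ and $\operatorname{sinc}(0)=1$. Let $f\in\mathbf{B}^p_\sigma(\Theta)$. Then $f$ has a (unique) continuous representative on $\mathbb{R}_+$, again denoted by $f$; it is differentiable at $1$, and for all $\tau\in\mathbb{R}_+$ $$f(\tau)=f(1)+\ln\tau\;(\partial_xf)(1)\,\operatorname{sinc}\left(\frac{\sigma}{\pi}\ln\tau\right)+\ln\tau\sum_{k\in\mathbb{Z}\setminus\{0\}}\frac{f\left(e^{k\pi/\sigma}\right)-f(1)}{k\pi/\sigma}\,\operatorname{sinc}\left(\frac{\sigma}{\pi}\ln\tau-k\right),$$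 where the series converges unconditionally, uniformly on compact subsets of $\mathbb{R}_+$. -/

import Mathlib

open Set Filter Topology MeasureTheory

namespace MellinBernstein

/-- The norm `‖f‖_{X^p(ℝ₊)} = ‖f(·) (·)^{-1/p}‖_{L^p(ℝ₊)}`. Functions on `ℝ₊ = (0, ∞)` are
represented by functions on `ℝ` whose values off `(0, ∞)` play no role. -/
noncomputable def xNorm (p : ℝ) (f : ℝ → ℂ) : ENNReal :=
  eLpNorm (fun x : ℝ => f x * ((x ^ (-1 / p) : ℝ) : ℂ)) (ENNReal.ofReal p)
    (volume.restrict (Ioi (0 : ℝ)))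

/-- `f ∈ X^p(ℝ₊)`, i.e. `f(·) (·)^{-1/p} ∈ L^p(ℝ₊)`. -/
def MemX (p : ℝ) (f : ℝ → ℂ) : Prop :=
  MemLp (fun x : ℝ => f x * ((x ^ (-1 / p) : ℝ) : ℂ)) (ENNReal.ofReal p)
    (volume.restrict (Ioi (0 : ℝ)))

/-- The group of Mellin translations, `U(t) f (x) = f(e^t x)`. -/
noncomputable def mellinTranslation (t : ℝ) (f : ℝ → ℂ) : ℝ → ℂ :=
  fun x => f (Real.exp t * x)

/-- `f` is in the domain of the infinitesimal generator `Θ = x d/dx` of the group `U` in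
`X^p(ℝ₊)`, and `Θ f = g`: the quotients `(U(t) f - f) / t` tend to `g` in the norm of `X^p(ℝ₊)`
as `t → 0`. Such a `g` is unique almost everywhere on `(0, ∞)`. -/
def HasTheta (p : ℝ) (f g : ℝ → ℂ) : Prop :=
  MemX p f ∧ MemX p g ∧
    Tendsto (fun t : ℝ => xNorm p (fun x => (mellinTranslation t f x - f x) / (t : ℂ) - g x))
      (𝓝[≠] 0) (𝓝 0)

/-- The Bernstein space `B_σ^p(Θ)`: all `f` in `X^p(ℝ₊)` which lie in the domain of every power
`Θ^k` (the function `F k` is `Θ^k f`) and satisfy `‖Θ^k f‖ ≤ σ^k ‖f‖` for all `k`. -/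
def MemBernstein (p σ : ℝ) (f : ℝ → ℂ) : Prop :=
  MemX p f ∧ ∃ F : ℕ → ℝ → ℂ, F 0 = f ∧ (∀ k, HasTheta p (F k) (F (k + 1))) ∧
    ∀ k, xNorm p (F k) ≤ ENNReal.ofReal (σ ^ k) * xNorm p f

/-- `g` is a continuous representative on `ℝ₊` of the element of `X^p(ℝ₊)` given by `f`. -/
def IsContinuousRep (f g : ℝ → ℂ) : Prop :=
  ContinuousOn g (Ioi (0 : ℝ)) ∧ f =ᵐ[volume.restrict (Ioi (0 : ℝ))] g

/-- The normalized cardinal sine, `sinc x = sin (π x) / (π x)` and `sinc 0 = 1`. -/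
noncomputable def nsinc (x : ℝ) : ℝ := Real.sinc (Real.pi * x)

/-- The `k`-th term, as a function of `τ`, of the sampling series of the difference quotient:
`(f(e^{kπ/σ}) - f(1)) / (kπ/σ) * sinc ((σ/π) ln τ - k)`. -/
noncomputable def samplingTerm (σ : ℝ) (f : ℝ → ℂ) (k : ℤ) (τ : ℝ) : ℂ :=
  (f (Real.exp ((k : ℝ) * Real.pi / σ)) - f 1) / (((k : ℝ) * Real.pi / σ : ℝ) : ℂ) *
    ((nsinc (σ / Real.pi * Real.log τ - (k : ℝ)) : ℝ) : ℂ)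

end MellinBernstein

/-!
In the variable `u = ln x` the generator `Θ` becomes `d/du` on `L^p(ℝ)`, so by a Sobolev estimate
`h u = f(e^u)` is smooth and its `k`-th derivative is bounded by a constant multiple of `σ ^ k`.
After rescaling to `σ = π`, the difference quotient `q` of `h` at `0` satisfies the same kind of
bounds and decays like `|u|⁻¹`, so for fixed `u` the product `x ↦ sinc (u - x) q x` is integrable
and its Fourier transform is supported in `[-1, 1]`. Being continuous, the transform vanishes at
`±1` as well, so Poisson summation gives the same value `∫ y, sinc (u - y) q y` for the sums of the
product over `ℤ` and over `u + ℤ`. The first sum is the cardinal series of `q` at `u`, and the only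
nonzero term of the second is `q u`.
-/

namespace MellinBernstein

open scoped ContDiff FourierTransform
open Function Metric

/-- `f` is smooth and its `k`-th derivative is at most `w x * σ ^ k` in norm at every point `x`.
For a constant weight `w` these are the restrictions to `ℝ` of the entire functions of exponential
type `σ` which are bounded on `ℝ`; a decaying `w` records the decay of all derivatives at once. -/
structure BernsteinBound {E : Type*} [NormedAddCommGroup E] [NormedSpace ℝ E]
    (w : ℝ → ℝ) (σ : ℝ) (f : ℝ → E) : Prop where
  contDiff : ContDiff ℝ ∞ f
  norm_iteratedDeriv_le : ∀ k x, ‖iteratedDeriv k f x‖ ≤ w x * σ ^ k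

section HasDerivAtSucc

variable {E : Type*} [NormedAddCommGroup E] [NormedSpace ℝ E] {F : ℕ → ℝ → E}

theorem iteratedDeriv_eq_of_hasDerivAt_succ (hF : ∀ k x, HasDerivAt (F k) (F (k + 1) x) x)
    (k : ℕ) : iteratedDeriv k (F 0) = F k := by
  induction k with
  | zero => exact iteratedDeriv_zero
  | succ k ih => rw [iteratedDeriv_succ, ih]; exact funext fun x => (hF k x).deriv

theorem contDiff_of_hasDerivAt_succ (hF : ∀ k x, HasDerivAt (F k) (F (k + 1) x) x) :
    ContDiff ℝ ∞ (F 0) :=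
  contDiff_of_differentiable_iteratedDeriv fun k _ => by
    rw [iteratedDeriv_eq_of_hasDerivAt_succ hF]
    exact fun x => (hF k x).differentiableAt

end HasDerivAtSucc

namespace BernsteinBound

variable {E : Type*} [NormedAddCommGroup E] [NormedSpace ℝ E] {w w' : ℝ → ℝ} {σ σ' : ℝ} {f : ℝ → E}

theorem of_hasDerivAt_succ {F : ℕ → ℝ → E} (hF : ∀ k x, HasDerivAt (F k) (F (k + 1) x) x)
    (hw : ∀ k x, ‖F k x‖ ≤ w x * σ ^ k) : BernsteinBound w σ (F 0) where
  contDiff := contDiff_of_hasDerivAt_succ hF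
  norm_iteratedDeriv_le k x := by
    rw [iteratedDeriv_eq_of_hasDerivAt_succ hF]
    exact hw k x

theorem norm_le (hf : BernsteinBound w σ f) (x : ℝ) : ‖f x‖ ≤ w x := by
  simpa using hf.norm_iteratedDeriv_le 0 x

theorem weight_nonneg (hf : BernsteinBound w σ f) (x : ℝ) : 0 ≤ w x :=
  (norm_nonneg _).trans (hf.norm_le x)

theorem mono_weight (hf : BernsteinBound w σ f) (hσ : 0 ≤ σ) (hw : ∀ x, w x ≤ w' x) :
    BernsteinBound w' σ f where
  contDiff := hf.contDiff
  norm_iteratedDeriv_le k x :=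
    (hf.norm_iteratedDeriv_le k x).trans (mul_le_mul_of_nonneg_right (hw x) (pow_nonneg hσ k))

theorem comp_const_mul (hf : BernsteinBound w σ f) (c : ℝ) :
    BernsteinBound (fun x => w (c * x)) (|c| * σ) (fun x => f (c * x)) where
  contDiff := hf.contDiff.comp (contDiff_const.mul contDiff_id)
  norm_iteratedDeriv_le k x := by
    rw [iteratedDeriv_comp_const_smul (hf.contDiff.of_le (mod_cast le_top)), norm_smul, norm_pow,
      Real.norm_eq_abs, mul_pow, mul_left_comm]
    exact mul_le_mul_of_nonneg_left (hf.norm_iteratedDeriv_le k _) (by positivity)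

theorem comp_const_sub (hf : BernsteinBound w σ f) (a : ℝ) :
    BernsteinBound (fun x => w (a - x)) σ (fun x => f (a - x)) where
  contDiff := hf.contDiff.comp (contDiff_const.sub contDiff_id)
  norm_iteratedDeriv_le k x := by
    simpa [iteratedDeriv_comp_const_sub, norm_smul] using hf.norm_iteratedDeriv_le k (a - x)

theorem smul {φ : ℝ → ℝ} (hφ : BernsteinBound w σ φ) (hf : BernsteinBound w' σ' f) :
    BernsteinBound (fun x => w x * w' x) (σ + σ') (fun x => φ x • f x) where
  contDiff := hφ.contDiff.smul hf.contDiff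
  norm_iteratedDeriv_le k x := by
    rw [← norm_iteratedFDeriv_eq_norm_iteratedDeriv]
    calc ‖iteratedFDeriv ℝ k (fun x => φ x • f x) x‖
        ≤ ∑ i ∈ Finset.range (k + 1),
            k.choose i * ‖iteratedFDeriv ℝ i φ x‖ * ‖iteratedFDeriv ℝ (k - i) f x‖ :=
          norm_iteratedFDeriv_smul_le hφ.contDiff hf.contDiff x (mod_cast le_top)
      _ ≤ ∑ i ∈ Finset.range (k + 1), k.choose i * (w x * σ ^ i) * (w' x * σ' ^ (k - i)) := by
          simp only [norm_iteratedFDeriv_eq_norm_iteratedDeriv]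
          gcongr with i
          · exact mul_nonneg (Nat.cast_nonneg _)
              ((norm_nonneg _).trans (hφ.norm_iteratedDeriv_le i x))
          · exact hφ.norm_iteratedDeriv_le i x
          · exact hf.norm_iteratedDeriv_le (k - i) x
      _ = w x * w' x * (σ + σ') ^ k := by
          rw [add_pow, Finset.mul_sum]
          exact Finset.sum_congr rfl fun i _ => by ring

theorem integrable_iteratedDeriv (hf : BernsteinBound w σ f) (hw : Integrable w) (k : ℕ) :
    Integrable (iteratedDeriv k f) :=
  (hw.mul_const (σ ^ k)).mono'
    (hf.contDiff.continuous_iteratedDeriv k (mod_cast le_top)).aestronglyMeasurable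
    (Eventually.of_forall (hf.norm_iteratedDeriv_le k))

end BernsteinBound

section PaleyWiener

variable {E : Type*} [NormedAddCommGroup E] [NormedSpace ℂ E] {w : ℝ → ℝ} {σ : ℝ} {f : ℝ → E}

theorem BernsteinBound.pow_mul_norm_fourier_le (hf : BernsteinBound w σ f) (hw : Integrable w)
    (k : ℕ) (ξ : ℝ) : (2 * Real.pi * |ξ|) ^ k * ‖𝓕 f ξ‖ ≤ (∫ x, w x) * σ ^ k := by
  have hfourier : ‖𝓕 (iteratedDeriv k f) ξ‖ = (2 * Real.pi * |ξ|) ^ k * ‖𝓕 f ξ‖ := by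
    rw [Real.fourier_iteratedDeriv (N := ⊤) hf.contDiff
      (fun n _ => hf.integrable_iteratedDeriv hw n) le_top]
    simp [norm_smul, abs_of_pos Real.pi_pos]
  calc (2 * Real.pi * |ξ|) ^ k * ‖𝓕 f ξ‖ = ‖𝓕 (iteratedDeriv k f) ξ‖ := hfourier.symm
    _ ≤ ∫ x, ‖iteratedDeriv k f x‖ :=
        VectorFourier.norm_fourierIntegral_le_integral_norm _ _ _ _ _
    _ ≤ ∫ x, w x * σ ^ k := integral_mono (hf.integrable_iteratedDeriv hw k).norm
        (hw.mul_const _) (hf.norm_iteratedDeriv_le k)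
    _ = (∫ x, w x) * σ ^ k := integral_mul_const _ _

theorem BernsteinBound.support_fourier_subset_closedBall (hf : BernsteinBound w σ f)
    (hw : Integrable w) (hσ : 0 < σ) : support (𝓕 f) ⊆ closedBall 0 (σ / (2 * Real.pi)) := by
  intro ξ hξ
  rw [mem_closedBall_zero_iff, Real.norm_eq_abs, le_div_iff₀' Real.two_pi_pos]
  by_contra! hlt
  have hgrowth : Tendsto (fun k : ℕ => (2 * Real.pi * |ξ| / σ) ^ k * ‖𝓕 f ξ‖) atTop atTop :=
    (tendsto_pow_atTop_atTop_of_one_lt ((one_lt_div hσ).2 hlt)).atTop_mul_const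
      (norm_pos_iff.2 hξ)
  obtain ⟨k, hk⟩ := (hgrowth.eventually_gt_atTop (∫ x, w x)).exists
  rw [div_pow, div_mul_eq_mul_div, lt_div_iff₀ (pow_pos hσ k)] at hk
  exact hk.not_ge (hf.pow_mul_norm_fourier_le hw k ξ)

theorem BernsteinBound.support_fourier_subset_ball (hf : BernsteinBound w σ f)
    (hw : Integrable w) (hσ : 0 < σ) : support (𝓕 f) ⊆ ball 0 (σ / (2 * Real.pi)) := by
  have hcont : Continuous (𝓕 f) :=
    VectorFourier.fourierIntegral_continuous Real.continuous_fourierChar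
      (by exact continuous_inner) (by simpa using hf.integrable_iteratedDeriv hw 0)
  rw [← interior_closedBall 0 (by positivity)]
  exact interior_maximal (hf.support_fourier_subset_closedBall hw hσ) hcont.isOpen_support

end PaleyWiener

section Poisson

theorem isBigO_inv_one_add_sq :
    (fun x : ℝ => (1 + x ^ 2)⁻¹) =O[cocompact ℝ] fun x => |x| ^ (-2 : ℝ) := by
  refine .of_bound 1 ?_
  filter_upwards [(isCompact_singleton (x := (0 : ℝ))).compl_mem_cocompact] with x hx
  have hx : 0 < x ^ 2 := sq_pos_of_ne_zero hx
  rw [Real.rpow_neg (abs_nonneg x), Real.rpow_two, sq_abs, Real.norm_of_nonneg (by positivity),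
    Real.norm_of_nonneg (by positivity), one_mul]
  exact inv_anti₀ hx (by linarith)

theorem summable_inv_one_add_int_sq : Summable fun n : ℤ => (1 + (n : ℝ) ^ 2)⁻¹ := by
  refine .of_norm_bounded_eventually (Real.summable_one_div_int_pow.2 one_lt_two) ?_
  filter_upwards [(Set.finite_singleton (0 : ℤ)).compl_mem_cofinite] with n hn
  have hn : (0 : ℝ) < (n : ℝ) ^ 2 := sq_pos_of_ne_zero (Int.cast_ne_zero.2 hn)
  rw [Real.norm_of_nonneg (by positivity), one_div]
  exact inv_anti₀ hn (by linarith)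

/-- All terms of the Fourier side of Poisson's formula vanish except the zeroth, because `𝓕 f`
vanishes at the end points of `[-1, 1]` as well. -/
theorem BernsteinBound.tsum_add_int {A : ℝ} {f : ℝ → ℂ}
    (hf : BernsteinBound (fun x => A * (1 + x ^ 2)⁻¹) (2 * Real.pi) f) (x : ℝ) :
    ∑' n : ℤ, f (x + n) = ∫ y, f y := by
  have hfourier : ∀ n : ℤ, n ≠ 0 → 𝓕 f n = 0 := fun n hn => by
    refine notMem_support.1 fun hmem => ?_
    have hlt := hf.support_fourier_subset_ball (integrable_inv_one_add_sq.const_mul A)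
      Real.two_pi_pos hmem
    rw [div_self Real.two_pi_pos.ne', mem_ball_zero_iff, Real.norm_eq_abs] at hlt
    exact hlt.not_ge (mod_cast Int.one_le_abs hn)
  have hdecay : f =O[cocompact ℝ] fun x => |x| ^ (-2 : ℝ) :=
    .trans (.of_norm_le hf.norm_le) (isBigO_inv_one_add_sq.const_mul_left A)
  rw [Real.tsum_eq_tsum_fourier_of_rpow_decay_of_summable hf.contDiff.continuous one_lt_two hdecay
    (summable_of_ne_finset_zero (s := {0}) fun n hn => hfourier n (by simpa using hn)),
    tsum_eq_single 0 fun n hn => by rw [hfourier n hn, zero_mul]]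
  simp [Real.fourier_real_eq]

end Poisson

section DifferenceQuotient

variable {E : Type*} [NormedAddCommGroup E] [NormedSpace ℝ E]

/-- The `k`-th derivative at `x` of the difference quotient of `f` at `a`, as the average
`∫₀¹ sᵏ f⁽ᵏ⁺¹⁾(a + s (x - a)) ds`. -/
noncomputable def dslopeDeriv (f : ℝ → E) (a : ℝ) (k : ℕ) (x : ℝ) : E :=
  ∫ s in (0 : ℝ)..1, s ^ k • iteratedDeriv (k + 1) f (a + s * (x - a))

variable {f : ℝ → E}

theorem hasDerivAt_integral_pow_smul {g : ℝ → E} (hg : ContDiff ℝ 1 g) (k : ℕ) (a x : ℝ) :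
    HasDerivAt (fun x => ∫ s in (0 : ℝ)..1, s ^ k • g (a + s * (x - a)))
      (∫ s in (0 : ℝ)..1, s ^ (k + 1) • deriv g (a + s * (x - a))) x := by
  have : Continuous (deriv g) := hg.continuous_deriv le_rfl
  obtain ⟨B, hB⟩ := (isCompact_Icc.prod (isCompact_closedBall x 1)).exists_bound_of_continuousOn
    (f := fun z : ℝ × ℝ => z.1 ^ (k + 1) • deriv g (a + z.1 * (z.2 - a)))
    (s := Icc 0 1 ×ˢ closedBall x 1) (by fun_prop)
  refine (intervalIntegral.hasDerivAt_integral_of_dominated_loc_of_deriv_le (bound := fun _ => B)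
    (F' := fun y s => s ^ (k + 1) • deriv g (a + s * (y - a))) (ball_mem_nhds x one_pos)
    (.of_forall fun y => Continuous.aestronglyMeasurable (by fun_prop))
    (Continuous.intervalIntegrable (by fun_prop) _ _)
    (Continuous.aestronglyMeasurable (by fun_prop))
    (.of_forall fun s hs y hy => ?_) intervalIntegrable_const (.of_forall fun s _ y _ => ?_)).2
  · rw [uIoc_of_le zero_le_one] at hs
    exact hB (s, y) ⟨Ioc_subset_Icc_self hs, ball_subset_closedBall hy⟩
  · have hline : HasDerivAt (fun y => a + s * (y - a)) s y := by
      simpa using (((hasDerivAt_id y).sub_const a).const_mul s).const_add a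
    have hderiv := ((hg.differentiable one_ne_zero _).hasDerivAt.scomp y hline).const_smul (s ^ k)
    rwa [smul_smul, ← pow_succ] at hderiv

theorem hasDerivAt_dslopeDeriv (hf : ContDiff ℝ ∞ f) (a : ℝ) (k : ℕ) (x : ℝ) :
    HasDerivAt (dslopeDeriv f a k) (dslopeDeriv f a (k + 1) x) x := by
  have hderiv := hasDerivAt_integral_pow_smul
    (hf.iterate_deriv (k + 1) |>.of_le (mod_cast le_top)) k a x
  simp only [← iteratedDeriv_eq_iterate, ← iteratedDeriv_succ] at hderiv
  exact hderiv

theorem sub_smul_dslopeDeriv_succ [CompleteSpace E] (hf : ContDiff ℝ ∞ f) (a : ℝ) (k : ℕ) (x : ℝ) :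
    (x - a) • dslopeDeriv f a (k + 1) x =
      iteratedDeriv (k + 1) f x - (k + 1 : ℝ) • dslopeDeriv f a k x := by
  have hcont (n : ℕ) : Continuous (iteratedDeriv n f) :=
    hf.continuous_iteratedDeriv n (mod_cast le_top)
  have hint (c : ℝ) (n m : ℕ) : IntervalIntegrable
      (fun s : ℝ => c • s ^ n • iteratedDeriv m f (a + s * (x - a))) volume 0 1 :=
    (((continuous_pow n).smul ((hcont m).comp (by fun_prop))).const_smul c).intervalIntegrable _ _
  have hderiv (s : ℝ) : HasDerivAt
      (fun s : ℝ => s ^ (k + 1) • iteratedDeriv (k + 1) f (a + s * (x - a)))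
      ((x - a) • s ^ (k + 1) • iteratedDeriv (k + 2) f (a + s * (x - a)) +
        (k + 1 : ℝ) • s ^ k • iteratedDeriv (k + 1) f (a + s * (x - a))) s := by
    have hline : HasDerivAt (fun s => a + s * (x - a)) (x - a) s := by
      simpa using ((hasDerivAt_id s).mul_const (x - a)).const_add a
    have hdiff : HasDerivAt (iteratedDeriv (k + 1) f)
        (iteratedDeriv (k + 2) f (a + s * (x - a))) (a + s * (x - a)) := by
      rw [iteratedDeriv_succ (n := k + 1)]
      exact (hf.differentiable_iteratedDeriv (k + 1) (mod_cast WithTop.coe_lt_top _) _).hasDerivAt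
    refine ((hasDerivAt_pow (k + 1) s).smul (hdiff.scomp s hline)).congr_deriv ?_
    simp [smul_smul, mul_comm]
  have hftc := intervalIntegral.integral_eq_sub_of_hasDerivAt (fun s _ => hderiv s)
    ((hint _ _ _).add (hint _ _ _))
  rw [intervalIntegral.integral_add (hint _ _ _) (hint _ _ _),
    intervalIntegral.integral_smul, intervalIntegral.integral_smul] at hftc
  rw [eq_sub_iff_add_eq]
  simpa [dslopeDeriv] using hftc

theorem dslopeDeriv_zero [CompleteSpace E] (hf : ContDiff ℝ 1 f) (a : ℝ) :
    dslopeDeriv f a 0 = dslope f a := by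
  funext x
  rcases eq_or_ne x a with rfl | hx
  · simp [dslopeDeriv]
  have hftc := intervalIntegral.integral_unitInterval_deriv_eq_sub (z₀ := a) (z₁ := x - a)
    ((hf.continuous_deriv le_rfl).comp (by fun_prop)).continuousOn
    fun t _ => (hf.differentiable one_ne_zero _).hasDerivAt
  rw [add_sub_cancel, ← sub_smul_dslope] at hftc
  simpa [dslopeDeriv] using smul_right_injective E (sub_ne_zero.2 hx) hftc

theorem BernsteinBound.norm_dslopeDeriv_le {C σ : ℝ} (hf : BernsteinBound (fun _ => C) σ f)
    (a : ℝ) (k : ℕ) (x : ℝ) : ‖dslopeDeriv f a k x‖ ≤ C * σ ^ (k + 1) / (k + 1) := by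
  calc ‖dslopeDeriv f a k x‖ ≤ ∫ s in (0 : ℝ)..1, s ^ k * (C * σ ^ (k + 1)) := by
        refine intervalIntegral.norm_integral_le_of_norm_le zero_le_one
          (.of_forall fun s hs => ?_) (Continuous.intervalIntegrable (by fun_prop) _ _)
        have hs : 0 ≤ s ^ k := pow_nonneg hs.1.le k
        rw [norm_smul, Real.norm_of_nonneg hs]
        exact mul_le_mul_of_nonneg_left (hf.norm_iteratedDeriv_le _ _) hs
    _ = C * σ ^ (k + 1) / (k + 1) := by
        rw [intervalIntegral.integral_mul_const, integral_pow]
        simp [div_eq_inv_mul]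

theorem BernsteinBound.abs_sub_mul_norm_dslopeDeriv_le [CompleteSpace E] {C σ : ℝ}
    (hf : BernsteinBound (fun _ => C) σ f) (a : ℝ) (k : ℕ) (x : ℝ) :
    |x - a| * ‖dslopeDeriv f a k x‖ ≤ 2 * C * σ ^ k := by
  rw [← Real.norm_eq_abs, ← norm_smul]
  cases k with
  | zero =>
    rw [dslopeDeriv_zero (hf.contDiff.of_le (mod_cast le_top)), sub_smul_dslope]
    linarith [norm_sub_le (f x) (f a), hf.norm_le x, hf.norm_le a]
  | succ k =>
    have hk : (0 : ℝ) < k + 1 := k.cast_add_one_pos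
    calc ‖(x - a) • dslopeDeriv f a (k + 1) x‖
        = ‖iteratedDeriv (k + 1) f x - (k + 1 : ℝ) • dslopeDeriv f a k x‖ := by
          rw [sub_smul_dslopeDeriv_succ hf.contDiff]
      _ ≤ C * σ ^ (k + 1) + (k + 1) * (C * σ ^ (k + 1) / (k + 1)) := by
          refine (norm_sub_le _ _).trans (add_le_add (hf.norm_iteratedDeriv_le _ _) ?_)
          rw [norm_smul, Real.norm_of_nonneg hk.le]
          exact mul_le_mul_of_nonneg_left (hf.norm_dslopeDeriv_le a k x) hk.le
      _ = 2 * C * σ ^ (k + 1) := by rw [mul_div_cancel₀ _ hk.ne']; ring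

protected theorem BernsteinBound.dslope [CompleteSpace E] {C σ : ℝ}
    (hf : BernsteinBound (fun _ => C) σ f) (hσ : 0 ≤ σ) (a : ℝ) :
    BernsteinBound (fun x => C * (2 + σ) * (1 + |x - a|)⁻¹) σ (dslope f a) := by
  have hC : 0 ≤ C := hf.weight_nonneg 0
  rw [← dslopeDeriv_zero (hf.contDiff.of_le (mod_cast le_top))]
  refine .of_hasDerivAt_succ (hasDerivAt_dslopeDeriv hf.contDiff a) fun k x => ?_
  have hnear : ‖dslopeDeriv f a k x‖ ≤ C * σ ^ (k + 1) :=
    (hf.norm_dslopeDeriv_le a k x).trans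
      (div_le_self (by positivity) (le_add_of_nonneg_left k.cast_nonneg))
  rw [mul_right_comm, ← div_eq_mul_inv, le_div_iff₀ (by positivity)]
  linear_combination hnear + hf.abs_sub_mul_norm_dslopeDeriv_le a k x

theorem dslope_comp_const_mul (f : ℝ → E) (c x : ℝ) :
    dslope (fun x => f (c * x)) 0 x = c • dslope f 0 (c * x) := by
  rcases eq_or_ne x 0 with rfl | hx
  · simp [deriv_comp_mul_left]
  · refine smul_right_injective E hx ?_
    have h₁ := sub_smul_dslope (fun x => f (c * x)) 0 x
    have h₂ := sub_smul_dslope f 0 (c * x)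
    simp only [sub_zero, mul_zero] at h₁ h₂
    simp only [h₁, smul_smul, mul_comm x c, h₂]

end DifferenceQuotient

section CardinalSeries

theorem bernsteinBound_sin : BernsteinBound (fun _ => 1) 1 Real.sin where
  contDiff := Real.contDiff_sin
  norm_iteratedDeriv_le k x := by simpa using Real.abs_iteratedDeriv_sin_le_one k x

theorem bernsteinBound_nsinc : BernsteinBound (fun x => 3 * (1 + |x|)⁻¹) Real.pi nsinc := by
  have hsinc : BernsteinBound (fun x => 3 * (1 + |x|)⁻¹) 1 Real.sinc := by
    rw [Real.sinc_eq_dslope]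
    refine (bernsteinBound_sin.dslope zero_le_one 0).mono_weight zero_le_one fun x => ?_
    norm_num
  have hscale := hsinc.comp_const_mul Real.pi
  rw [abs_of_pos Real.pi_pos, mul_one] at hscale
  refine hscale.mono_weight Real.pi_pos.le fun x => ?_
  have hx : |x| ≤ |Real.pi * x| := by
    rw [abs_mul, abs_of_pos Real.pi_pos]
    exact le_mul_of_one_le_left (abs_nonneg x) (by linarith [Real.pi_gt_three])
  gcongr

theorem nsinc_zero : nsinc 0 = 1 := by simp [nsinc]

theorem nsinc_intCast {n : ℤ} (hn : n ≠ 0) : nsinc n = 0 := by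
  have hn : Real.pi * n ≠ 0 := mul_ne_zero Real.pi_ne_zero (Int.cast_ne_zero.2 hn)
  rw [nsinc, Real.sinc_of_ne_zero hn, mul_comm, Real.sin_int_mul_pi, zero_div]

theorem inv_one_add_abs_sub_mul_inv_one_add_abs_le (u x : ℝ) :
    (1 + |u - x|)⁻¹ * (1 + |x|)⁻¹ ≤ (1 + |u|) * (1 + x ^ 2)⁻¹ := by
  have htri : |x| ≤ |u| + |u - x| := by
    simpa [abs_sub_comm] using abs_sub_le x u 0 |>.trans_eq (add_comm _ _)
  have hpeetre : 1 + |x| ≤ (1 + |u|) * (1 + |u - x|) := by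
    linarith [mul_nonneg (abs_nonneg u) (abs_nonneg (u - x))]
  have hsq : 1 + x ^ 2 ≤ (1 + |x|) * (1 + |x|) := by
    linarith [sq_abs x, abs_nonneg x]
  rw [← mul_inv, ← div_eq_mul_inv, ← one_div, div_le_div_iff₀ (by positivity) (by positivity)]
  calc 1 * (1 + x ^ 2) ≤ (1 + |x|) * (1 + |x|) := by rwa [one_mul]
    _ ≤ (1 + |u|) * (1 + |u - x|) * (1 + |x|) := by gcongr
    _ = (1 + |u|) * ((1 + |u - x|) * (1 + |x|)) := by ring

theorem BernsteinBound.nsinc_smul {E : Type*} [NormedAddCommGroup E] [NormedSpace ℝ E] {A : ℝ}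
    {q : ℝ → E} (hq : BernsteinBound (fun x => A * (1 + |x|)⁻¹) Real.pi q) (u : ℝ) :
    BernsteinBound (fun x => 3 * A * (1 + |u|) * (1 + x ^ 2)⁻¹) (2 * Real.pi)
      (fun x => nsinc (u - x) • q x) := by
  have hA : 0 ≤ A := by simpa using hq.weight_nonneg 0
  have hprod := (bernsteinBound_nsinc.comp_const_sub u).smul hq
  rw [← two_mul] at hprod
  refine hprod.mono_weight Real.two_pi_pos.le fun x => ?_
  linear_combination 3 * A * inv_one_add_abs_sub_mul_inv_one_add_abs_le u x

theorem BernsteinBound.hasSum_nsinc_smul {A : ℝ} {q : ℝ → ℂ}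
    (hq : BernsteinBound (fun x => A * (1 + |x|)⁻¹) Real.pi q) (u : ℝ) :
    HasSum (fun n : ℤ => nsinc (u - n) • q n) (q u) := by
  have hprod := hq.nsinc_smul u
  have hsum : Summable fun n : ℤ => nsinc (u - n) • q n :=
    (summable_inv_one_add_int_sq.mul_left _).of_norm_bounded fun n => hprod.norm_le n
  have hshift : ∑' n : ℤ, nsinc (u - (u + n)) • q (u + n) = q u := by
    rw [tsum_eq_single 0 fun n hn => ?_]
    · simp [nsinc_zero]
    · rw [sub_add_cancel_left, ← Int.cast_neg, nsinc_intCast (neg_ne_zero.2 hn), zero_smul]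
  rw [← hshift, hprod.tsum_add_int u, ← hprod.tsum_add_int 0]
  simpa only [zero_add] using hsum.hasSum

variable {f : ℝ → ℂ} {C σ : ℝ}

theorem BernsteinBound.dslope_comp_pi_div_mul (hf : BernsteinBound (fun _ => C) σ f)
    (hσ : 0 < σ) :
    BernsteinBound (fun x => C * (2 + Real.pi) * (1 + |x|)⁻¹) Real.pi
      (fun x => (Real.pi / σ) • dslope f 0 (Real.pi / σ * x)) := by
  have hscale := hf.comp_const_mul (Real.pi / σ)
  rw [abs_of_pos (by positivity), div_mul_cancel₀ _ hσ.ne'] at hscale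
  have hslope := hscale.dslope Real.pi_pos.le 0
  rw [funext (dslope_comp_const_mul f _)] at hslope
  simpa only [sub_zero] using hslope

theorem BernsteinBound.hasSum_nsinc_smul_dslope (hf : BernsteinBound (fun _ => C) σ f)
    (hσ : 0 < σ) (u : ℝ) :
    HasSum (fun k : ℤ => nsinc (σ / Real.pi * u - k) • dslope f 0 (k * Real.pi / σ))
      (dslope f 0 u) := by
  have hc : Real.pi / σ ≠ 0 := by positivity
  have hu : Real.pi / σ * (σ / Real.pi * u) = u := by field_simp
  have hnode (k : ℤ) : k * Real.pi / σ = Real.pi / σ * k := by ring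
  have hsum := ((hf.dslope_comp_pi_div_mul hσ).hasSum_nsinc_smul (σ / Real.pi * u)).const_smul
    (Real.pi / σ)⁻¹
  simp only [hu, smul_comm (nsinc _), inv_smul_smul₀ hc] at hsum
  simpa only [hnode] using hsum

theorem BernsteinBound.norm_nsinc_smul_dslope_le (hf : BernsteinBound (fun _ => C) σ f)
    (hσ : 0 < σ) (v : ℝ) (k : ℤ) :
    ‖nsinc (v - k) • dslope f 0 (k * Real.pi / σ)‖ ≤
      σ / Real.pi * (3 * (C * (2 + Real.pi)) * (1 + |v|) * (1 + (k : ℝ) ^ 2)⁻¹) := by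
  have hbound := ((hf.dslope_comp_pi_div_mul hσ).nsinc_smul v).norm_le k
  have hnode : k * Real.pi / σ = Real.pi / σ * k := by ring
  rw [smul_comm, norm_smul, Real.norm_of_nonneg (by positivity)] at hbound
  rwa [hnode, ← inv_div Real.pi σ, le_inv_mul_iff₀ (by positivity)]

end CardinalSeries

section LpGenerator

variable {E : Type*} [NormedAddCommGroup E] [NormedSpace ℝ E] {p : ENNReal}

theorem tendsto_intervalIntegral_of_tendsto_eLpNorm {ι : Type*} {l : Filter ι} {G : ι → ℝ → E}
    {g : ℝ → E} (hp : 1 ≤ p) (hG : ∀ i, MemLp (G i) p) (hg : MemLp g p)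
    (hlim : Tendsto (fun i => eLpNorm (G i - g) p) l (𝓝 0)) (a b : ℝ) :
    Tendsto (fun i => ∫ u in a..b, G i u) l (𝓝 (∫ u in a..b, g u)) := by
  simp only [intervalIntegral.intervalIntegral_eq_integral_uIoc]
  have : IsFiniteMeasure (volume.restrict (uIoc a b)) :=
    isFiniteMeasure_restrict.2 measure_Ioc_lt_top.ne
  refine (tendsto_integral_of_L1' g hg.1.restrict
    (.of_forall fun i => ((hG i).restrict _).integrable hp) ?_).const_smul _
  have hexp : 0 ≤ 1 / (1 : ENNReal).toReal - 1 / p.toReal := by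
    rcases eq_or_ne p ⊤ with rfl | hp_top
    · simp
    · have hp' : 1 ≤ p.toReal := by simpa using ENNReal.toReal_mono hp_top hp
      simpa using inv_le_one_of_one_le₀ hp'
  have hzero := ENNReal.Tendsto.mul_const hlim
    (.inr (ENNReal.rpow_ne_top_of_nonneg hexp (measure_ne_top (volume.restrict (uIoc a b)) univ)))
  rw [zero_mul] at hzero
  refine tendsto_of_tendsto_of_tendsto_of_le_of_le tendsto_const_nhds hzero (fun _ => zero_le)
    fun i => ?_
  refine (eLpNorm_le_eLpNorm_mul_rpow_measure_univ hp ((hG i).sub hg).1.restrict).trans ?_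
  gcongr
  exact Measure.restrict_le_self

theorem tendsto_intervalIntegral_slope {h : ℝ → E} {a b : ℝ} (hh : LocallyIntegrable h)
    (ha : HasDerivAt (fun x => ∫ u in a..x, h u) (h a) a)
    (hb : HasDerivAt (fun x => ∫ u in a..x, h u) (h b) b) :
    Tendsto (fun t : ℝ => ∫ u in a..b, t⁻¹ • (h (t + u) - h u)) (𝓝[≠] 0) (𝓝 (h b - h a)) := by
  have hint (x y : ℝ) : IntervalIntegrable h volume x y :=
    (hh.integrableOn_isCompact isCompact_uIcc).intervalIntegrable
  refine (hb.tendsto_slope_zero.sub ha.tendsto_slope_zero).congr fun t => ?_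
  have hshift : IntervalIntegrable (fun u => h (t + u)) volume a b := by
    simpa using (hint (t + a) (t + b)).comp_add_left (c := t)
  rw [intervalIntegral.integral_smul, intervalIntegral.integral_sub hshift (hint a b),
    intervalIntegral.integral_comp_add_left, ← smul_sub, intervalIntegral.integral_same, sub_zero,
    add_comm b, add_comm a,
    ← intervalIntegral.integral_interval_sub_left (hint a (t + b)) (hint a (t + a))]
  congr 1
  abel

theorem exists_ae_eq_primitive [CompleteSpace E] {h g : ℝ → E} (hp : 1 ≤ p) (hh : MemLp h p)
    (hg : MemLp g p)
    (hlim : Tendsto (fun t : ℝ => eLpNorm (fun u => t⁻¹ • (h (t + u) - h u) - g u) p)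
      (𝓝[≠] 0) (𝓝 0)) :
    ∃ (a : ℝ) (c : E), h =ᵐ[volume] fun x => c + ∫ u in a..x, g u := by
  have hloc : LocallyIntegrable h := hh.locallyIntegrable hp
  have hquot (t : ℝ) : MemLp (fun u => t⁻¹ • (h (t + u) - h u)) p :=
    ((hh.comp_measurePreserving (measurePreserving_add_left volume t)).sub hh).const_smul t⁻¹
  have hlebesgue := LocallyIntegrable.ae_hasDerivAt_integral hloc
  obtain ⟨a, ha⟩ := hlebesgue.exists
  refine ⟨a, h a, ?_⟩
  filter_upwards [hlebesgue] with b hb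
  rw [← tendsto_nhds_unique (tendsto_intervalIntegral_slope hloc (ha a) (hb a))
    (tendsto_intervalIntegral_of_tendsto_eLpNorm hp hquot hg hlim a b), add_sub_cancel]

theorem exists_hasDerivAt_succ_of_ae_eq_primitive [CompleteSpace E] {φ : ℕ → ℝ → E}
    (hφ : ∀ k, LocallyIntegrable (φ k))
    (hprim : ∀ k, ∃ (a : ℝ) (c : E), φ k =ᵐ[volume] fun x => c + ∫ u in a..x, φ (k + 1) u) :
    ∃ H : ℕ → ℝ → E, (∀ k, φ k =ᵐ[volume] H k) ∧ ∀ k x, HasDerivAt (H k) (H (k + 1) x) x := by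
  choose a c hac using hprim
  set H : ℕ → ℝ → E := fun k x => c k + ∫ u in (a k)..x, φ (k + 1) u
  have hcont (k : ℕ) : Continuous (H k) :=
    continuous_const.add (intervalIntegral.continuous_primitive
      (fun _ _ => ((hφ (k + 1)).integrableOn_isCompact isCompact_uIcc).intervalIntegrable) _)
  have hprimitive (k : ℕ) : H k = fun x => c k + ∫ u in (a k)..x, H (k + 1) u :=
    funext fun x => congrArg (c k + ·)
      (intervalIntegral.integral_congr_ae ((hac (k + 1)).mono fun _ hu _ => hu))
  refine ⟨H, hac, fun k x => ?_⟩
  rw [hprimitive k]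
  exact ((hcont (k + 1)).integral_hasStrictDerivAt (a k) x).hasDerivAt.const_add _

theorem enorm_le_enorm_add_lintegral_enorm_deriv [CompleteSpace E] {h h' : ℝ → E}
    (hderiv : ∀ x, HasDerivAt h (h' x) x) (hcont : Continuous h') {x y : ℝ} (hxy : x ≤ y) :
    ‖h x‖ₑ ≤ ‖h y‖ₑ + ∫⁻ z in Ioc x y, ‖h' z‖ₑ := by
  have hftc : h x = h y - ∫ z in Ioc x y, h' z := by
    rw [← intervalIntegral.integral_of_le hxy, intervalIntegral.integral_eq_sub_of_hasDerivAt
      (fun z _ => hderiv z) (hcont.intervalIntegrable x y), sub_sub_cancel]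
  calc ‖h x‖ₑ ≤ ‖h y‖ₑ + ‖∫ z in Ioc x y, h' z‖ₑ := hftc ▸ enorm_sub_le
    _ ≤ ‖h y‖ₑ + ∫⁻ z in Ioc x y, ‖h' z‖ₑ := by
        gcongr
        exact enorm_integral_le_lintegral_enorm _

theorem enorm_le_eLpNorm_add_eLpNorm_deriv [CompleteSpace E] {h h' : ℝ → E} (hp : 1 ≤ p)
    (hderiv : ∀ x, HasDerivAt h (h' x) x) (hcont : Continuous h') (x : ℝ) :
    ‖h x‖ₑ ≤ eLpNorm h p + eLpNorm h' p := by
  have hh : Continuous h := continuous_iff_continuousAt.2 fun x => (hderiv x).continuousAt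
  have : IsProbabilityMeasure (volume.restrict (Ioc x (x + 1))) := ⟨by simp⟩
  have hle {φ : ℝ → E} (hφ : Continuous φ) : ∫⁻ y in Ioc x (x + 1), ‖φ y‖ₑ ≤ eLpNorm φ p := by
    rw [← eLpNorm_one_eq_lintegral_enorm]
    exact (eLpNorm_le_eLpNorm_of_exponent_le hp hφ.aestronglyMeasurable).trans
      (eLpNorm_restrict_le _ _ _ _)
  have hpointwise : ∀ y ∈ Ioc x (x + 1),
      ‖h x‖ₑ ≤ ‖h y‖ₑ + ∫⁻ z in Ioc x (x + 1), ‖h' z‖ₑ := fun y hy => by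
    refine (enorm_le_enorm_add_lintegral_enorm_deriv hderiv hcont hy.1.le).trans ?_
    gcongr
    exact hy.2
  have haverage := setLIntegral_mono' (μ := volume) measurableSet_Ioc hpointwise
  rw [lintegral_add_right _ measurable_const, lintegral_const, measure_univ, mul_one,
    lintegral_const, measure_univ, mul_one] at haverage
  exact haverage.trans (add_le_add (hle hh) (hle hcont))

theorem BernsteinBound.of_eLpNorm_le [CompleteSpace E] {F : ℕ → ℝ → E} {N : ENNReal}
    {σ : ℝ} (hp : 1 ≤ p) (hσ : 0 ≤ σ) (hN : N ≠ ⊤) (hF : ∀ k x, HasDerivAt (F k) (F (k + 1) x) x)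
    (hbound : ∀ k, eLpNorm (F k) p ≤ ENNReal.ofReal (σ ^ k) * N) :
    BernsteinBound (fun _ => (1 + σ) * N.toReal) σ (F 0) := by
  refine .of_hasDerivAt_succ hF fun k x => ?_
  have hcont : Continuous (F (k + 1)) :=
    continuous_iff_continuousAt.2 fun x => (hF (k + 1) x).continuousAt
  have hle := (enorm_le_eLpNorm_add_eLpNorm_deriv hp (hF k) hcont x).trans
    (add_le_add (hbound k) (hbound (k + 1)))
  rw [← ENNReal.ofReal_toReal hN, ← ENNReal.ofReal_mul (by positivity),
    ← ENNReal.ofReal_mul (by positivity), ← ENNReal.ofReal_add (by positivity) (by positivity),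
    ← ofReal_norm, ENNReal.ofReal_le_ofReal_iff (by positivity)] at hle
  linear_combination hle

end LpGenerator

section LogarithmicVariable

theorem quasiMeasurePreserving_exp :
    Measure.QuasiMeasurePreserving Real.exp volume (volume.restrict (Ioi (0 : ℝ))) := by
  refine ⟨Real.measurable_exp, Measure.AbsolutelyContinuous.mk fun s hs hs_null => ?_⟩
  rw [Measure.restrict_apply hs] at hs_null
  rw [Measure.map_apply Real.measurable_exp hs]
  have hpreimage : Real.exp ⁻¹' s ⊆ Real.log '' (s ∩ Ioi 0) := fun x hx =>
    ⟨Real.exp x, ⟨hx, Real.exp_pos x⟩, Real.log_exp x⟩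
  exact measure_mono_null hpreimage (addHaar_image_eq_zero_of_differentiableOn_of_addHaar_eq_zero
    volume (Real.differentiableOn_log.mono fun x hx => ne_of_gt hx.2) hs_null)

theorem quasiMeasurePreserving_log :
    Measure.QuasiMeasurePreserving Real.log (volume.restrict (Ioi (0 : ℝ))) volume := by
  refine ⟨Real.measurable_log, Measure.AbsolutelyContinuous.mk fun s hs hs_null => ?_⟩
  rw [Measure.map_apply Real.measurable_log hs, Measure.restrict_apply (Real.measurable_log hs)]
  have hpreimage : Real.log ⁻¹' s ∩ Ioi 0 ⊆ Real.exp '' s := fun x hx =>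
    ⟨Real.log x, hx.1, Real.exp_log hx.2⟩
  exact measure_mono_null hpreimage (addHaar_image_eq_zero_of_differentiableOn_of_addHaar_eq_zero
    volume Real.differentiable_exp.differentiableOn hs_null)

theorem xNorm_eq_eLpNorm_comp_exp {p : ℝ} (hp : 0 < p) (f : ℝ → ℂ) :
    xNorm p f = eLpNorm (fun u => f (Real.exp u)) (ENNReal.ofReal p) := by
  have hp0 : ENNReal.ofReal p ≠ 0 := by simpa using hp
  have hweight (u : ℝ) :
      ‖((Real.exp u ^ (-1 / p) : ℝ) : ℂ)‖ₑ ^ p = ENNReal.ofReal (Real.exp (-u)) := by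
    rw [← Real.exp_mul, ← ofReal_norm, Complex.norm_real, Real.norm_of_nonneg (Real.exp_pos _).le,
      ENNReal.ofReal_rpow_of_nonneg (Real.exp_pos _).le hp.le, ← Real.exp_mul, mul_assoc,
      div_mul_cancel₀ _ hp.ne', mul_neg_one]
  rw [xNorm, eLpNorm_eq_lintegral_rpow_enorm_toReal hp0 ENNReal.ofReal_ne_top,
    eLpNorm_eq_lintegral_rpow_enorm_toReal hp0 ENNReal.ofReal_ne_top, ENNReal.toReal_ofReal hp.le,
    ← Real.range_exp, ← image_univ, lintegral_image_eq_lintegral_abs_deriv_mul MeasurableSet.univ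
    (fun x _ => (Real.hasDerivAt_exp x).hasDerivWithinAt) Real.exp_injective.injOn,
    Measure.restrict_univ]
  refine congrArg (· ^ (1 / p)) (lintegral_congr fun u => ?_)
  rw [enorm_mul, ENNReal.mul_rpow_of_nonneg _ _ hp.le, hweight, mul_left_comm,
    ← ENNReal.ofReal_mul (abs_nonneg _), abs_of_pos (Real.exp_pos u), ← Real.exp_add,
    add_neg_cancel, Real.exp_zero, ENNReal.ofReal_one, mul_one]

theorem MemX.memLp_comp_exp {p : ℝ} (hp : 0 < p) {f : ℝ → ℂ} (hf : MemX p f) :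
    MemLp (fun u => f (Real.exp u)) (ENNReal.ofReal p) := by
  refine ⟨?_, (xNorm_eq_eLpNorm_comp_exp hp f).symm.trans_lt hf.2⟩
  have hweight : Continuous fun u => ((Real.exp (u / p) : ℝ) : ℂ) := by fun_prop
  refine ((hf.1.comp_quasiMeasurePreserving quasiMeasurePreserving_exp).mul
    hweight.aestronglyMeasurable).congr (.of_forall fun u => ?_)
  have hcancel : Real.exp u ^ (-1 / p) * Real.exp (u / p) = 1 := by
    rw [← Real.exp_mul, ← Real.exp_add, mul_div_assoc', mul_neg_one, neg_div, neg_add_cancel,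
      Real.exp_zero]
  simp only [Pi.mul_apply, comp_apply]
  rw [mul_assoc, ← Complex.ofReal_mul, hcancel, Complex.ofReal_one, mul_one]

theorem HasTheta.exists_ae_eq_primitive {p : ℝ} (hp : 1 ≤ p) {f g : ℝ → ℂ} (h : HasTheta p f g) :
    ∃ (a : ℝ) (c : ℂ),
      (fun u => f (Real.exp u)) =ᵐ[volume] fun x => c + ∫ u in a..x, g (Real.exp u) := by
  have hp0 : 0 < p := zero_lt_one.trans_le hp
  obtain ⟨hf, hg, hlim⟩ := h
  refine MellinBernstein.exists_ae_eq_primitive (ENNReal.one_le_ofReal.2 hp)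
    (hf.memLp_comp_exp hp0) (hg.memLp_comp_exp hp0) ?_
  simpa only [xNorm_eq_eLpNorm_comp_exp hp0, mellinTranslation, ← Real.exp_add, Complex.real_smul,
    Complex.ofReal_inv, ← div_eq_inv_mul] using hlim

theorem MemBernstein.exists_bernsteinBound {p σ : ℝ} {f : ℝ → ℂ} (hf : MemBernstein p σ f)
    (hp : 1 ≤ p) (hσ : 0 ≤ σ) :
    ∃ (C : ℝ) (h : ℝ → ℂ), BernsteinBound (fun _ => C) σ h ∧
      (fun u => f (Real.exp u)) =ᵐ[volume] h := by
  obtain ⟨hfX, F, rfl, hF, hbound⟩ := hf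
  have hp0 : 0 < p := zero_lt_one.trans_le hp
  have hp1 : 1 ≤ ENNReal.ofReal p := ENNReal.one_le_ofReal.2 hp
  obtain ⟨H, hae, hderiv⟩ := exists_hasDerivAt_succ_of_ae_eq_primitive
    (fun k => ((hF k).1.memLp_comp_exp hp0).locallyIntegrable hp1)
    fun k => (hF k).exists_ae_eq_primitive hp
  refine ⟨_, H 0, .of_eLpNorm_le hp1 hσ hfX.2.ne hderiv fun k => ?_, hae 0⟩
  rw [← eLpNorm_congr_ae (hae k), ← xNorm_eq_eLpNorm_comp_exp hp0]
  exact hbound k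

theorem isContinuousRep_comp_log {f h : ℝ → ℂ} (hh : Continuous h)
    (hfh : (fun u => f (Real.exp u)) =ᵐ[volume] h) :
    IsContinuousRep f (fun x => h (Real.log x)) := by
  refine ⟨hh.comp_continuousOn (Real.continuousOn_log.mono fun x hx => ne_of_gt hx), ?_⟩
  filter_upwards [quasiMeasurePreserving_log.ae_eq_comp hfh, ae_restrict_mem measurableSet_Ioi]
    with x hx hx0
  simpa only [comp_apply, Real.exp_log hx0] using hx

theorem IsContinuousRep.comp_exp_eq {f g h : ℝ → ℂ} (hg : IsContinuousRep f g)
    (hh : Continuous h) (hfh : (fun u => f (Real.exp u)) =ᵐ[volume] h) :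
    (fun u => g (Real.exp u)) = h :=
  (Continuous.ae_eq_iff_eq volume (hg.1.comp_continuous Real.continuous_exp Real.exp_pos) hh).1
    ((quasiMeasurePreserving_exp.ae_eq_comp hg.2).symm.trans hfh)

end LogarithmicVariable

section Sampling

variable {g : ℝ → ℂ} {C σ : ℝ}

theorem hasDerivAt_one_of_comp_exp (hg : DifferentiableAt ℝ (fun u => g (Real.exp u)) 0) :
    HasDerivAt g (dslope (fun u => g (Real.exp u)) 0 0) 1 := by
  rw [dslope_same]
  have hlog : HasDerivAt Real.log 1 1 := by simpa using Real.hasDerivAt_log one_ne_zero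
  have hcomp := HasDerivAt.scomp_of_eq (1 : ℝ) hg.hasDerivAt hlog Real.log_one.symm
  rw [one_smul] at hcomp
  refine hcomp.congr_of_eventuallyEq ?_
  filter_upwards [Ioi_mem_nhds zero_lt_one] with x hx
  rw [comp_apply, Real.exp_log hx]

theorem samplingTerm_eq_nsinc_smul_dslope (hσ : σ ≠ 0) {k : ℤ} (hk : k ≠ 0) (τ : ℝ) :
    samplingTerm σ g k τ = nsinc (σ / Real.pi * Real.log τ - k) •
      dslope (fun u => g (Real.exp u)) 0 (k * Real.pi / σ) := by
  have hnode : (k : ℝ) * Real.pi / σ ≠ 0 :=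
    div_ne_zero (mul_ne_zero (Int.cast_ne_zero.2 hk) Real.pi_ne_zero) hσ
  rw [samplingTerm, dslope_of_ne _ hnode, slope_def_module, sub_zero, Real.exp_zero,
    Complex.real_smul, Complex.real_smul, Complex.ofReal_inv, div_eq_inv_mul, mul_comm]

theorem tendstoUniformlyOn_samplingTerm
    (hg : BernsteinBound (fun _ => C) σ fun u => g (Real.exp u)) (hσ : 0 < σ) {K : Set ℝ}
    (hK : IsCompact K) (hK_pos : K ⊆ Ioi 0) :
    TendstoUniformlyOn (fun (s : Finset {k : ℤ // k ≠ 0}) τ => ∑ k ∈ s, samplingTerm σ g k τ)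
      (fun τ => ∑' k : {k : ℤ // k ≠ 0}, samplingTerm σ g k τ) atTop K := by
  have hlog : ContinuousOn (fun τ => σ / Real.pi * Real.log τ) K :=
    continuousOn_const.mul (Real.continuousOn_log.mono fun x hx => ne_of_gt (hK_pos hx))
  obtain ⟨R, hR⟩ := hK.exists_bound_of_continuousOn hlog
  have hC : 0 ≤ C := hg.weight_nonneg 0
  have hsummable := (summable_inv_one_add_int_sq.mul_left
    (σ / Real.pi * (3 * (C * (2 + Real.pi)) * (1 + R)))).comp_injective
      (Subtype.val_injective (p := fun k : ℤ => k ≠ 0))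
  refine tendstoUniformlyOn_tsum hsummable fun k τ hτ => ?_
  rw [samplingTerm_eq_nsinc_smul_dslope hσ.ne' k.2]
  refine (hg.norm_nsinc_smul_dslope_le hσ _ k.1).trans ?_
  rw [← mul_assoc (σ / Real.pi), comp_apply]
  gcongr
  exact hR τ hτ

theorem dslope_comp_exp_eq_nsinc_smul_add_tsum_samplingTerm
    (hg : BernsteinBound (fun _ => C) σ fun u => g (Real.exp u)) (hσ : 0 < σ) (τ : ℝ) :
    dslope (fun u => g (Real.exp u)) 0 (Real.log τ) =
      nsinc (σ / Real.pi * Real.log τ) • dslope (fun u => g (Real.exp u)) 0 0 +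
        ∑' k : {k : ℤ // k ≠ 0}, samplingTerm σ g k τ := by
  have hsum := hg.hasSum_nsinc_smul_dslope hσ (Real.log τ)
  rw [← hsum.tsum_eq, ← hsum.summable.tsum_subtype_add_tsum_subtype_compl {0}]
  congr 1
  · simp [tsum_fintype]
  · exact tsum_congr fun k => (samplingTerm_eq_nsinc_smul_dslope hσ.ne' k.2 τ).symm

end Sampling

end MellinBernstein

theorem mainTheorem5_general (p σ : ℝ) (hp : 1 ≤ p) (hσ : 0 < σ) (f : ℝ → ℂ)
    (hf : MellinBernstein.MemBernstein p σ f) :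
    (∃ g : ℝ → ℂ, MellinBernstein.IsContinuousRep f g) ∧
    ∀ g : ℝ → ℂ, MellinBernstein.IsContinuousRep f g →
      DifferentiableAt ℝ g 1 ∧
      ∃ S : ℝ → ℂ,
        (∀ K : Set ℝ, K ⊆ Set.Ioi (0 : ℝ) → IsCompact K →
          TendstoUniformlyOn
            (fun (s : Finset {k : ℤ // k ≠ 0}) (τ : ℝ) =>
              ∑ k ∈ s, MellinBernstein.samplingTerm σ g (k : ℤ) τ)
            S Filter.atTop K) ∧
        ∀ τ : ℝ, 0 < τ →
          g τ = g 1
            + (Real.log τ : ℂ) * deriv g 1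
              * ((MellinBernstein.nsinc (σ / Real.pi * Real.log τ) : ℝ) : ℂ)
            + (Real.log τ : ℂ) * S τ := by
  obtain ⟨C, h, hh, hae⟩ := hf.exists_bernsteinBound hp hσ.le
  refine ⟨⟨_, MellinBernstein.isContinuousRep_comp_log hh.contDiff.continuous hae⟩,
    fun g hg => ?_⟩
  rw [← hg.comp_exp_eq hh.contDiff.continuous hae] at hh
  have hderiv := MellinBernstein.hasDerivAt_one_of_comp_exp
    (hh.contDiff.differentiable (by simp) 0)
  refine ⟨hderiv.differentiableAt, _, fun K hK_pos hK =>
    MellinBernstein.tendstoUniformlyOn_samplingTerm hh hσ hK hK_pos, fun τ hτ => ?_⟩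
  have hslope := sub_smul_dslope (fun u => g (Real.exp u)) 0 (Real.log τ)
  rw [MellinBernstein.dslope_comp_exp_eq_nsinc_smul_add_tsum_samplingTerm hh hσ, ← hderiv.deriv,
    Real.exp_log hτ, Real.exp_zero, sub_zero, Complex.real_smul, Complex.real_smul] at hslope
  linear_combination -hslope

theorem mainTheorem5 (p σ : ℝ) (hp : 1 < p) (hσ : 0 < σ) (f : ℝ → ℂ)
    (hf : MellinBernstein.MemBernstein p σ f) :
    (∃ g : ℝ → ℂ, MellinBernstein.IsContinuousRep f g) ∧
    ∀ g : ℝ → ℂ, MellinBernstein.IsContinuousRep f g →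
      DifferentiableAt ℝ g 1 ∧
      ∃ S : ℝ → ℂ,
        (∀ K : Set ℝ, K ⊆ Set.Ioi (0 : ℝ) → IsCompact K →
          TendstoUniformlyOn
            (fun (s : Finset {k : ℤ // k ≠ 0}) (τ : ℝ) =>
              ∑ k ∈ s, MellinBernstein.samplingTerm σ g (k : ℤ) τ)
            S Filter.atTop K) ∧
        ∀ τ : ℝ, 0 < τ →
          g τ = g 1
            + (Real.log τ : ℂ) * deriv g 1
              * ((MellinBernstein.nsinc (σ / Real.pi * Real.log τ) : ℝ) : ℂ)
            + (Real.log τ : ℂ) * S τ :=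
  mainTheorem5_general p σ hp.le hσ f hf
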